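/- Let $d\ge 1$ and let $U_0,\dots,U_d$ be $d+1$ i.i.d. random points, uniformly distributed on the unit sphere of $\mathbb R^d$. Let $\Delta_d(U_0,\dots,U_d)$ be the $d$-dimensional volume of the simplex with vertices $U_0,\dots,U_d$, let $P_{U_0^\perp}$ be the orthogonal projection onto the linear hyperplane $U_0^\perp$, and put $$C_d=\mathbb E\left[\Delta_d(U_0,\dots,U_d)\,\mathbf 1_{\{0\in \mathrm{Conv}(P_{U_0^\perp}(U_1),\dots,P_{U_0^\perp}(U_d))\}}\right].$$ Then $$C_d=\frac{\Gamma(d/2)^d}{2^{d-1}\sqrt{\pi}\,(d-1)!\,\Gamma((d+1)/2)^{d-1}},$$ and, for every $d\ge 2$, $$C_d=\frac{1}{2(d-1)}\left(\frac{B(d/2,1/2)}{B((d-1)/2,1/2)}\right)^{d-1}C_{d-1},$$ where $\Gamma$ and $B$ are the Gamma and Beta functions. All of this holds both when $\mathrm{Conv}$ denotes the convex hull of the specified points and when it denotes the relative interior of their convex hull. -/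

import Mathlib

open MeasureTheory ProbabilityTheory

/-- The uniform probability measure on the unit sphere of `ℝ^d`: the surface measure, divided by
its total mass. -/
noncomputable def uniformSphere (d : ℕ) :
    Measure (Metric.sphere (0 : EuclideanSpace ℝ (Fin d)) 1) :=
  ((volume : Measure (EuclideanSpace ℝ (Fin d))).toSphere Set.univ)⁻¹ •
    (volume : Measure (EuclideanSpace ℝ (Fin d))).toSphere

/-- `U 0, …, U d` are independent random points, each uniformly distributed on the unit sphere
of `ℝ^d`. -/
structure IIDUniformSphere (d : ℕ) {Ω : Type*} [MeasurableSpace Ω] (P : Measure Ω)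
    (U : Fin (d + 1) → Ω → Metric.sphere (0 : EuclideanSpace ℝ (Fin d)) 1) : Prop where
  hasLaw : ∀ i, HasLaw (U i) (uniformSphere d) P
  indep : iIndepFun U P

/-- The `d`-dimensional volume of the simplex with vertices `u 0, …, u d`. -/
noncomputable def simplexVolume {d : ℕ} (u : Fin (d + 1) → EuclideanSpace ℝ (Fin d)) : ℝ :=
  (volume : Measure (EuclideanSpace ℝ (Fin d))).real (convexHull ℝ (Set.range u))

/-- The set of the orthogonal projections of `u 1, …, u d` onto the hyperplane orthogonal
to `u 0`. -/
noncomputable def projectedPoints {d : ℕ} (u : Fin (d + 1) → EuclideanSpace ℝ (Fin d)) :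
    Set (EuclideanSpace ℝ (Fin d)) :=
  Set.range fun i : Fin d => (Submodule.span ℝ {u 0})ᗮ.starProjection (u i.succ)

/-- The configurations for which `0` lies in the convex hull of the projected points. -/
def hullConfigurations (d : ℕ) : Set (Fin (d + 1) → EuclideanSpace ℝ (Fin d)) :=
  {u | 0 ∈ convexHull ℝ (projectedPoints u)}

/-- The configurations for which `0` lies in the relative interior of the convex hull of the
projected points. -/
def relintConfigurations (d : ℕ) : Set (Fin (d + 1) → EuclideanSpace ℝ (Fin d)) :=
  {u | 0 ∈ intrinsicInterior ℝ (convexHull ℝ (projectedPoints u))}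

/-- The expected volume of the simplex with vertices `U 0, …, U d`, restricted to the event that
the configuration `(U 0, …, U d)` belongs to `S`. -/
noncomputable def expectedVolumeOn {d : ℕ} {Ω : Type*} [MeasurableSpace Ω] (P : Measure Ω)
    (U : Fin (d + 1) → Ω → Metric.sphere (0 : EuclideanSpace ℝ (Fin d)) 1)
    (S : Set (Fin (d + 1) → EuclideanSpace ℝ (Fin d))) : ℝ :=
  ∫ ω, S.indicator simplexVolume (fun i => (U i ω : EuclideanSpace ℝ (Fin d))) ∂P

/-! Write B for the determinant of `u 1, …, u d` and R_i for the one in which the i-th of these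
vectors is replaced by `u 0`. Cramer's rule gives ∑ R_i u_i = B u_0 (`sum_replacedDet_smul`).
Projecting onto the hyperplane orthogonal to `u 0` turns this into a linear relation between the
projected points with coefficients R_i, and for B ≠ 0 it pins down every relation up to scale.
Hence, when B and all R_i are nonzero, 0 lies in the hull of the projections exactly when all R_i
have the same sign, and then it lies in the relative interior. Both readings of Conv therefore agree
almost surely. The volume of the simplex is |B - ∑ R_i| / d!.

The law of the sample is invariant under sign changes of `u 1, …, u d`. A sign vector ε multiplies
R_i by ε_i ∏ ε, so exactly two opposite sign vectors produce a constant sign. Their volumes are |B -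
∑ |R_i|| / d! and |B + ∑ |R_i|| / d!. Since |B| ≤ ∑ |R_i| for unit vectors, they add up to 2 ∑ |R_i|
/ d! (`sum_signedVolume_flipTail`). Averaging over the 2^d sign vectors gives 2^d C_d = (2 / d!) · d
· E|det|, where det is the determinant of d independent uniform points.

That last expectation comes from the Gaussian one: directions and radii of Gaussian vectors are
independent, and the Gaussian determinant factors inductively into norms
(`lintegral_abs_rowDet_uniformSphere`, `lintegral_abs_rowDet_gaussianTuple`). The recursion is then
read off the closed form. -/

/-! ### Convex combinations and relative interiors. -/

section ConvexHull

/-- A point of the convex hull of a finite family is a convex combination of its points. -/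
theorem exists_weights_of_mem_convexHull_range {ι V : Type*} [Fintype ι] [AddCommGroup V]
    [Module ℝ V] {z : ι → V} {y : V} (hy : y ∈ convexHull ℝ (Set.range z)) :
    ∃ v : ι → ℝ, (∀ i, 0 ≤ v i) ∧ ∑ i, v i = 1 ∧ ∑ i, v i • z i = y := by
  classical
  rw [convexHull_range_eq_exists_affineCombination] at hy
  obtain ⟨s, v, h0, h1, rfl⟩ := hy
  refine ⟨fun i => if i ∈ s then v i else 0, fun i => ?_, ?_, ?_⟩
  · dsimp only
    split_ifs with hi
    exacts [h0 i hi, le_rfl]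
  · simpa using h1
  · rw [s.affineCombination_eq_linear_combination _ _ h1]
    simp

/-- A combination of finitely many points with positive weights lies in the relative interior of
their convex hull. -/
theorem sum_smul_mem_intrinsicInterior_convexHull {ι V : Type*} [Fintype ι] [NormedAddCommGroup V]
    [NormedSpace ℝ V] [FiniteDimensional ℝ V] (z : ι → V) (w : ι → ℝ) (hw : ∀ i, 0 < w i)
    (hsum : ∑ i, w i = 1) :
    ∑ i, w i • z i ∈ intrinsicInterior ℝ (convexHull ℝ (Set.range z)) := by
  have hne : Nonempty ι := by
    by_contra h
    rw [not_nonempty_iff] at h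
    simp at hsum
  set C := convexHull ℝ (Set.range z) with hC
  have hCc : Convex ℝ C := convex_convexHull ℝ _
  have hCne : C.Nonempty := (Set.range_nonempty z).convexHull
  obtain ⟨y, hy⟩ := hCne.intrinsicInterior hCc
  obtain ⟨v, hv0, hv1, hvy⟩ := exists_weights_of_mem_convexHull_range (intrinsicInterior_subset hy)
  obtain ⟨i₀, hi₀⟩ := Finite.exists_min w
  -- Half the least weight: every `w i - t * v i` stays nonnegative and `t < 1`. The target point is
  -- then the image of the relative interior point `y` under a homothety of ratio `t` centred at a
  -- point `q` of the hull. Such a homothety is open and preserves the hull.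
  set t := w i₀ / 2 with ht
  have ht0 : 0 < t := half_pos (hw i₀)
  have hle : ∀ i, v i ≤ 1 := fun i => by
    rw [← hv1]
    exact Finset.single_le_sum (fun j _ => hv0 j) (Finset.mem_univ i)
  have hwle : w i₀ ≤ 1 := by
    rw [← hsum]
    exact Finset.single_le_sum (fun j _ => (hw j).le) (Finset.mem_univ i₀)
  have ht1 : 0 < 1 - t := by linarith
  set q := ∑ i, ((w i - t * v i) / (1 - t)) • z i with hq
  have hqC : q ∈ C := by
    refine hCc.sum_mem (fun i _ => div_nonneg ?_ ht1.le) ?_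
      fun i _ => subset_convexHull ℝ _ (Set.mem_range_self i)
    · nlinarith [hi₀ i, hle i, hv0 i]
    · rw [← Finset.sum_div, Finset.sum_sub_distrib, ← Finset.mul_sum, hsum, hv1, mul_one,
        div_self ht1.ne']
  have hx : ∑ i, w i • z i = AffineMap.homothety q t y := by
    rw [AffineMap.homothety_apply, vsub_eq_sub, vadd_eq_add, smul_sub, ← hvy, hq,
      Finset.smul_sum, Finset.smul_sum, ← Finset.sum_sub_distrib, ← Finset.sum_add_distrib]
    refine Finset.sum_congr rfl fun i _ => ?_
    rw [smul_smul, smul_smul, ← sub_smul, ← add_smul]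
    congr 1
    field_simp
    ring
  have : Nonempty (affineSpan ℝ C) := ⟨⟨q, subset_affineSpan ℝ _ hqC⟩⟩
  rw [mem_intrinsicInterior] at hy ⊢
  obtain ⟨y', hy', rfl⟩ := hy
  let q' : affineSpan ℝ C := ⟨q, subset_affineSpan ℝ _ hqC⟩
  refine ⟨AffineMap.homothety q' t y', ?_, ?_⟩
  · refine interior_maximal ?_ ((AffineMap.homothety_isOpenMap q' t ht0.ne') _ isOpen_interior)
      (Set.mem_image_of_mem _ hy')
    rintro _ ⟨p, hp, rfl⟩
    have hp' : p ∈ ((↑) : affineSpan ℝ C → V) ⁻¹' C := interior_subset hp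
    have := hCc hqC (Set.mem_preimage.1 hp') ht1.le ht0.le (by ring)
    change ((AffineMap.homothety q' t p : affineSpan ℝ C) : V) ∈ C
    convert this using 1
    simp [AffineMap.homothety_apply, q', smul_sub, sub_smul]
    abel
  · rw [hx]
    simp [AffineMap.homothety_apply, q']

end ConvexHull

/-! ### Volume of a simplex as a determinant. -/

section SimplexVolume

/-- The volume of the corner simplex `{x ≥ 0, ∑ x ≤ t}`. -/
theorem volume_setOf_nonneg_sum_le (n : ℕ) {t : ℝ} (ht : 0 ≤ t) :
    volume {x : Fin n → ℝ | (∀ i, 0 ≤ x i) ∧ ∑ i, x i ≤ t} =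
      ENNReal.ofReal (t ^ n / n.factorial) := by
  induction n generalizing t with
  | zero => simp [ht, volume_pi]
  | succ n ih =>
    have hmeas : ∀ (m : ℕ) (s : ℝ),
        MeasurableSet {x : Fin m → ℝ | (∀ i, 0 ≤ x i) ∧ ∑ i, x i ≤ s} := fun m s => by
      refine IsClosed.measurableSet ?_
      simp only [Set.ofPred_and, Set.ofPred_forall]
      exact (isClosed_iInter fun i => isClosed_le continuous_const (continuous_apply i)).inter
        (isClosed_le (by fun_prop) continuous_const)
    have e := volume_preserving_piFinSuccAbove (fun _ : Fin (n + 1) => ℝ) 0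
    rw [← e.symm.measure_preimage (hmeas (n + 1) t).nullMeasurableSet, Measure.volume_eq_prod,
      Measure.prod_apply (e.symm.measurable (hmeas (n + 1) t))]
    -- Fixing the first coordinate `s` leaves a corner simplex of size `t - s`, empty unless `0 ≤ s
    -- ≤ t`.
    have hslice : ∀ s : ℝ, volume (Prod.mk s ⁻¹'
          ((MeasurableEquiv.piFinSuccAbove (fun _ : Fin (n + 1) => ℝ) 0).symm ⁻¹'
            {x : Fin (n + 1) → ℝ | (∀ i, 0 ≤ x i) ∧ ∑ i, x i ≤ t})) =
        (Set.Icc 0 t).indicator (fun s => ENNReal.ofReal ((t - s) ^ n / n.factorial)) s := by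
      intro s
      by_cases hs : s ∈ Set.Icc 0 t
      · rw [Set.indicator_of_mem hs, ← ih (sub_nonneg.2 hs.2)]
        congr 1
        ext y
        simp [MeasurableEquiv.piFinSuccAbove, Fin.forall_fin_succ, Fin.sum_univ_succ, hs.1,
          le_sub_iff_add_le']
      · rw [Set.indicator_of_notMem hs]
        refine measure_mono_null (t := ∅) ?_ measure_empty
        intro y hy
        simp only [MeasurableEquiv.piFinSuccAbove, Fin.forall_fin_succ, Fin.sum_univ_succ,
          Set.mem_preimage, Set.mem_ofPred_eq] at hy
        simp at hy
        exact hs ⟨hy.1.1, by linarith [Finset.sum_nonneg fun i (_ : i ∈ Finset.univ) => hy.1.2 i]⟩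
    simp_rw [hslice]
    rw [lintegral_indicator measurableSet_Icc, ← ofReal_integral_eq_lintegral_ofReal]
    · congr 1
      rw [integral_Icc_eq_integral_Ioc, ← intervalIntegral.integral_of_le ht,
        intervalIntegral.integral_div,
        intervalIntegral.integral_comp_sub_left (fun x => x ^ n), sub_self, sub_zero,
        integral_pow, Nat.factorial_succ]
      push_cast
      field_simp
      simp
    · exact (Continuous.integrableOn_Icc (by fun_prop))
    · filter_upwards [ae_restrict_mem measurableSet_Icc] with s hs
      have := sub_nonneg.2 hs.2
      positivity

/-- The determinant of the matrix whose rows are the vectors `v i`. -/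
noncomputable def rowDet {n : ℕ} (v : Fin n → EuclideanSpace ℝ (Fin n)) : ℝ :=
  (Matrix.of fun i j => v i j).det

/-- Eliminating the barycentric weight of `u 0` presents the simplex as a translated linear image of
the corner simplex, whose volume is known. -/
theorem convexHull_range_eq_image {n : ℕ} {V : Type*} [AddCommGroup V] [Module ℝ V]
    (u : Fin (n + 1) → V) :
    convexHull ℝ (Set.range u) =
      (fun x : Fin n → ℝ => u 0 + ∑ i, x i • (u i.succ - u 0)) ''
        {x | (∀ i, 0 ≤ x i) ∧ ∑ i, x i ≤ 1} := by
  apply Set.Subset.antisymm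
  · have hconv : Convex ℝ ((fun x : Fin n → ℝ => u 0 + ∑ i, x i • (u i.succ - u 0)) ''
        {x | (∀ i, 0 ≤ x i) ∧ ∑ i, x i ≤ 1}) := by
      rintro _ ⟨x, hx, rfl⟩ _ ⟨y, hy, rfl⟩ a b ha hb hab
      refine ⟨a • x + b • y, ⟨fun i => ?_, ?_⟩, ?_⟩
      · have := hx.1 i
        have := hy.1 i
        simp only [Pi.add_apply, Pi.smul_apply, smul_eq_mul]
        positivity
      · simp only [Pi.add_apply, Pi.smul_apply, smul_eq_mul, Finset.sum_add_distrib,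
          ← Finset.mul_sum]
        nlinarith [hx.2, hy.2]
      · simp only [Pi.add_apply, Pi.smul_apply, smul_eq_mul, add_smul, Finset.sum_add_distrib,
          smul_add, Finset.smul_sum, smul_smul]
        nth_rewrite 1 [← one_smul ℝ (u 0)]
        rw [← hab, add_smul]
        abel
    refine convexHull_min ?_ hconv
    rintro _ ⟨k, rfl⟩
    refine Fin.cases ?_ (fun i => ?_) k
    · exact ⟨0, by simp, by simp⟩
    · refine ⟨Pi.single i 1, ⟨fun j => ?_, ?_⟩, ?_⟩
      · by_cases h : j = i
        · subst h; simp
        · simp [h]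
      · simp
      · simp [Pi.single_apply]
  · rintro _ ⟨x, hx, rfl⟩
    have hmem : ∑ k, (Fin.cons (1 - ∑ i, x i) x : Fin (n + 1) → ℝ) k • u k ∈
        convexHull ℝ (Set.range u) := by
      refine (convex_convexHull ℝ _).sum_mem (fun k _ => ?_) ?_
        fun k _ => subset_convexHull ℝ _ (Set.mem_range_self k)
      · refine Fin.cases ?_ (fun i => ?_) k
        · simpa using hx.2
        · simpa using hx.1 i
      · simp [Fin.sum_univ_succ]
    convert hmem using 1
    simp [Fin.sum_univ_succ, smul_sub, sub_smul, Finset.sum_smul]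
    abel

theorem simplexVolume_eq {n : ℕ} (u : Fin (n + 1) → EuclideanSpace ℝ (Fin n)) :
    simplexVolume u = |rowDet fun i => u i.succ - u 0| / n.factorial := by
  let A : Matrix (Fin n) (Fin n) ℝ := Matrix.of fun i j => (u i.succ - u 0) j
  -- The edges are the rows of `A`, so combining them with coefficients `x` is the action of the
  -- transpose.
  let f : (Fin n → ℝ) →ₗ[ℝ] (Fin n → ℝ) := Matrix.toLin' A.transpose
  have himg : (WithLp.ofLp) '' (convexHull ℝ (Set.range u)) =
      (fun x => WithLp.ofLp (u 0) + x) '' (f '' {x | (∀ i, 0 ≤ x i) ∧ ∑ i, x i ≤ 1}) := by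
    rw [convexHull_range_eq_image, Set.image_image, Set.image_image]
    refine Set.image_congr fun x _ => ?_
    ext j
    simp [f, A, Matrix.mulVec, dotProduct, mul_comm]
  have hvol : volume (convexHull ℝ (Set.range u)) =
      volume (WithLp.ofLp '' (convexHull ℝ (Set.range u))) := by
    have := (EuclideanSpace.volume_preserving_symm_measurableEquiv_toLp (Fin n)).symm
    rw [← this.measure_preimage_equiv]
    congr 1
    ext x
    simp only [Set.mem_preimage, Set.mem_image]
    constructor
    · intro hx
      exact ⟨_, hx, rfl⟩
    · rintro ⟨y, hy, rfl⟩
      exact hy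
  rw [simplexVolume, Measure.real, hvol, himg, Set.image_add_left, measure_preimage_add,
    Measure.addHaar_image_linearMap, volume_setOf_nonneg_sum_le n zero_le_one, ENNReal.toReal_mul,
    ENNReal.toReal_ofReal (abs_nonneg _), ENNReal.toReal_ofReal (by positivity)]
  simp [f, A, rowDet, div_eq_mul_inv]

end SimplexVolume

/-! ### Density of the standard Gaussian measure. -/

section StdGaussian

/-- The density of the standard Gaussian measure on `ℝ^n`. -/
noncomputable def stdGaussianDensity (n : ℕ) (r : ℝ) : ℝ :=
  (2 * Real.pi) ^ (-(n / 2 : ℝ)) * Real.exp (-r ^ 2 / 2)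

theorem stdGaussianDensity_nonneg (n : ℕ) (r : ℝ) : 0 ≤ stdGaussianDensity n r := by
  unfold stdGaussianDensity
  positivity

@[fun_prop]
theorem continuous_stdGaussianDensity (n : ℕ) : Continuous (stdGaussianDensity n) := by
  unfold stdGaussianDensity
  fun_prop

theorem integral_stdGaussianDensity_norm (n : ℕ) :
    ∫ x : EuclideanSpace ℝ (Fin n), stdGaussianDensity n ‖x‖ = 1 := by
  have h := GaussianFourier.integral_rexp_neg_mul_sq_norm (V := EuclideanSpace ℝ (Fin n))
    (b := 1 / 2) (by norm_num)
  have hpi : (0 : ℝ) < 2 * Real.pi := by positivity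
  unfold stdGaussianDensity
  rw [integral_const_mul]
  have : ∀ x : EuclideanSpace ℝ (Fin n), Real.exp (-‖x‖ ^ 2 / 2) =
      Real.exp (-(1 / 2) * ‖x‖ ^ 2) := fun x => by ring_nf
  simp_rw [this]
  rw [h, finrank_euclideanSpace, Fintype.card_fin, show Real.pi / (1 / 2) = 2 * Real.pi by ring,
    ← Real.rpow_add hpi]
  simp

theorem integrable_stdGaussianDensity_norm (n : ℕ) :
    Integrable fun x : EuclideanSpace ℝ (Fin n) => stdGaussianDensity n ‖x‖ := by
  -- A nonintegrable function has integral 0 by convention, whereas this integral is 1.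
  by_contra h
  have := integral_stdGaussianDensity_norm n
  rw [integral_undef h] at this
  exact zero_ne_one this

/-- Both sides are finite measures with the same characteristic function. -/
theorem stdGaussian_eq_withDensity (n : ℕ) :
    stdGaussian (EuclideanSpace ℝ (Fin n)) =
      (volume : Measure (EuclideanSpace ℝ (Fin n))).withDensity
        fun x => ENNReal.ofReal (stdGaussianDensity n ‖x‖) := by
  have : IsFiniteMeasure ((volume : Measure (EuclideanSpace ℝ (Fin n))).withDensity
        fun x => ENNReal.ofReal (stdGaussianDensity n ‖x‖)) :=
    isFiniteMeasure_withDensity_ofReal (integrable_stdGaussianDensity_norm n).2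
  apply Measure.ext_of_charFun
  ext t
  rw [charFun_stdGaussian, charFun_apply, integral_withDensity_eq_integral_toReal_smul
    (by fun_prop) (by simp)]
  have h := GaussianFourier.integral_cexp_neg_mul_sq_norm_add (V := EuclideanSpace ℝ (Fin n))
    (b := 1 / 2) (by norm_num) Complex.I t
  have hpi : (2 * Real.pi : ℂ) ≠ 0 := by
    exact_mod_cast (by positivity : (2 * Real.pi : ℝ) ≠ 0)
  have heq : ∀ x : EuclideanSpace ℝ (Fin n),
      (ENNReal.ofReal (stdGaussianDensity n ‖x‖)).toReal • Complex.exp (inner ℝ x t * Complex.I) =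
        (2 * Real.pi : ℂ) ^ (-(n / 2 : ℂ)) *
          Complex.exp (-(1 / 2) * ‖x‖ ^ 2 + Complex.I * inner ℝ t x) := by
    intro x
    rw [ENNReal.toReal_ofReal (stdGaussianDensity_nonneg n _), stdGaussianDensity,
      Complex.real_smul, Complex.ofReal_mul, Complex.exp_add, Complex.ofReal_cpow (by positivity),
      real_inner_comm]
    push_cast
    ring_nf
  simp_rw [heq]
  rw [integral_const_mul, h, finrank_euclideanSpace, Fintype.card_fin,
    show (Real.pi / (1 / 2) : ℂ) = 2 * Real.pi by ring, ← mul_assoc, ← Complex.cpow_add _ _ hpi]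
  simp
  ring_nf

end StdGaussian

/-! ### Polar decomposition of a Gaussian vector. -/

section Polar

theorem isProbabilityMeasure_uniformSphere {n : ℕ} (hn : 1 ≤ n) :
    IsProbabilityMeasure (uniformSphere n) := by
  have : Nonempty (Fin n) := ⟨⟨0, hn⟩⟩
  constructor
  rw [uniformSphere, Measure.smul_apply, smul_eq_mul]
  refine ENNReal.inv_mul_cancel ?_ (measure_ne_top _ _)
  rw [Ne, Measure.measure_univ_eq_zero]
  exact Measure.toSphere_ne_zero _

/-- The expected norm of a standard Gaussian vector of `ℝ^n`. -/
noncomputable def gaussianMeanNorm (n : ℕ) : ℝ :=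
  Real.sqrt 2 * Real.Gamma ((n + 1) / 2) / Real.Gamma (n / 2)

/-- The law of the norm of a standard Gaussian vector of `ℝ^n`. -/
noncomputable def gaussianNormLaw (n : ℕ) : Measure (Set.Ioi (0 : ℝ)) :=
  (volume : Measure (EuclideanSpace ℝ (Fin n))).toSphere Set.univ •
    (Measure.volumeIoiPow (n - 1)).withDensity fun r => ENNReal.ofReal (stdGaussianDensity n r)

instance (n : ℕ) : SFinite (gaussianNormLaw n) := by
  unfold gaussianNormLaw
  infer_instance

/-- The density is radial, so polar coordinates split it into independent direction and radius. The
total surface mass removed from the direction is carried by the radial law. -/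
theorem map_smul_uniformSphere_prod_gaussianNormLaw {n : ℕ} (hn : 1 ≤ n) :
    ((uniformSphere n).prod (gaussianNormLaw n)).map
        (fun p => (p.2 : ℝ) • (p.1 : EuclideanSpace ℝ (Fin n))) =
      stdGaussian (EuclideanSpace ℝ (Fin n)) := by
  have : Nonempty (Fin n) := ⟨⟨0, hn⟩⟩
  set E := EuclideanSpace ℝ (Fin n)
  set c := (volume : Measure E).toSphere Set.univ with hc
  have hc0 : c ≠ 0 := by
    rw [hc, Ne, Measure.measure_univ_eq_zero]
    exact Measure.toSphere_ne_zero _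
  have hct : c ≠ ⊤ := measure_ne_top _ _
  have hprod : (uniformSphere n).prod (gaussianNormLaw n) =
      ((volume : Measure E).toSphere.prod (Measure.volumeIoiPow (n - 1))).withDensity
        fun z => ENNReal.ofReal (stdGaussianDensity n z.2) := by
    rw [uniformSphere, gaussianNormLaw, Measure.prod_smul_left, Measure.prod_smul_right,
      smul_smul, ENNReal.inv_mul_cancel hc0 hct, one_smul, prod_withDensity_right]
    fun_prop
  refine Measure.ext_of_lintegral _ fun f hf => ?_
  have hmp := (volume : Measure E).measurePreserving_homeomorphUnitSphereProd
  rw [finrank_euclideanSpace, Fintype.card_fin] at hmp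
  rw [lintegral_map hf (by fun_prop), hprod, lintegral_withDensity_eq_lintegral_mul _ (by fun_prop)
    (by fun_prop), stdGaussian_eq_withDensity, lintegral_withDensity_eq_lintegral_mul _
    (by fun_prop) hf, ← hmp.lintegral_comp (by fun_prop)]
  -- Polar coordinates exist only off the origin, which is a null set.
  rw [← lintegral_add_compl _ (measurableSet_singleton (0 : E))]
  rw [Measure.restrict_eq_zero.2 (measure_singleton 0), lintegral_zero_measure, zero_add,
    ← lintegral_subtype_comap (measurableSet_singleton (0 : E)).compl]
  refine lintegral_congr fun x => ?_
  have hx : ‖(x : E)‖ ≠ 0 := norm_ne_zero_iff.2 x.2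
  simp [smul_smul, hx]

theorem isProbabilityMeasure_gaussianNormLaw {n : ℕ} (hn : 1 ≤ n) :
    IsProbabilityMeasure (gaussianNormLaw n) := by
  have := isProbabilityMeasure_uniformSphere hn
  have h := congrArg (fun μ => μ Set.univ) (map_smul_uniformSphere_prod_gaussianNormLaw hn)
  rw [Measure.map_apply (by fun_prop) .univ, Set.preimage_univ, ← Set.univ_prod_univ,
    Measure.prod_prod, measure_univ, one_mul] at h
  exact ⟨h.trans measure_univ⟩

/-- The surface mass is left unevaluated: it cancels when the moments k = 0 and k = 1 are compared.
-/
theorem lintegral_pow_gaussianNormLaw {n : ℕ} (hn : 1 ≤ n) (k : ℕ) :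
    ∫⁻ r, ENNReal.ofReal (r ^ k) ∂(gaussianNormLaw n) =
      (volume : Measure (EuclideanSpace ℝ (Fin n))).toSphere Set.univ *
        ENNReal.ofReal ((2 * Real.pi) ^ (-(n / 2 : ℝ)) *
          (Real.sqrt 2 ^ (n + k) * (1 / 2) * Real.Gamma ((n + k) / 2))) := by
  have h2 : ∀ r : ℝ, 0 ≤ r → r ^ (n - 1) * (stdGaussianDensity n r * r ^ k) =
      (2 * Real.pi) ^ (-(n / 2 : ℝ)) *
        (r ^ ((n + k : ℝ) - 1) * Real.exp (-(1 / 2) * r ^ (2 : ℝ))) := by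
    intro r hr
    have : (n + k : ℝ) - 1 = ((n - 1 + k : ℕ) : ℝ) := by
      rw [Nat.cast_add, Nat.cast_sub hn]; push_cast; ring
    rw [this, Real.rpow_natCast, stdGaussianDensity, Real.rpow_two, pow_add]
    ring_nf
  have hnk : (0 : ℝ) < n + k := by
    have : (1 : ℝ) ≤ n := by exact_mod_cast hn
    positivity
  have hint := integrableOn_rpow_mul_exp_neg_mul_rpow (p := 2) (s := (n + k : ℝ) - 1)
    (b := 1 / 2) (by linarith) (by norm_num) (by norm_num)
  have hval := integral_rpow_mul_exp_neg_mul_rpow (p := 2) (q := (n + k : ℝ) - 1)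
    (b := 1 / 2) (by norm_num) (by linarith) (by norm_num)
  rw [gaussianNormLaw, lintegral_smul_measure, lintegral_withDensity_eq_lintegral_mul _
    (by fun_prop) (by fun_prop), Measure.volumeIoiPow, lintegral_withDensity_eq_lintegral_mul _
    (by fun_prop) (by fun_prop), smul_eq_mul]
  congr 1
  simp only [Pi.mul_apply]
  rw [lintegral_subtype_comap measurableSet_Ioi
    (fun r : ℝ => ENNReal.ofReal (r ^ (n - 1)) *
      (ENNReal.ofReal (stdGaussianDensity n r) * ENNReal.ofReal (r ^ k)))]
  rw [setLIntegral_congr_fun (g := fun r : ℝ => ENNReal.ofReal ((2 * Real.pi) ^ (-(n / 2 : ℝ)) *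
        (r ^ ((n + k : ℝ) - 1) * Real.exp (-(1 / 2) * r ^ (2 : ℝ))))) measurableSet_Ioi]
  · rw [← ofReal_integral_eq_lintegral_ofReal (hint.const_mul _), integral_const_mul, hval]
    · congr 2
      rw [sub_add_cancel]
      congr 2
      rw [one_div, Real.inv_rpow (by norm_num), ← Real.rpow_neg (by norm_num), Real.sqrt_eq_rpow,
        ← Real.rpow_natCast, ← Real.rpow_mul (by norm_num)]
      congr 1
      push_cast
      ring
    · filter_upwards [ae_restrict_mem measurableSet_Ioi] with r hr
      have := Set.mem_Ioi.1 hr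
      simp only [Pi.zero_apply]
      positivity
  · intro r hr
    have hr' := (Set.mem_Ioi.1 hr).le
    dsimp only
    rw [← h2 r hr', ENNReal.ofReal_mul (by positivity),
      ENNReal.ofReal_mul (stdGaussianDensity_nonneg n r)]

theorem lintegral_gaussianNormLaw {n : ℕ} (hn : 1 ≤ n) :
    ∫⁻ r, ENNReal.ofReal r ∂(gaussianNormLaw n) = ENNReal.ofReal (gaussianMeanNorm n) := by
  have := isProbabilityMeasure_gaussianNormLaw hn
  have h0 := lintegral_pow_gaussianNormLaw hn 0
  have h1 := lintegral_pow_gaussianNormLaw hn 1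
  have hn' : (0 : ℝ) < n := by exact_mod_cast hn
  have hΓ : 0 < Real.Gamma (n / 2) := Real.Gamma_pos_of_pos (by positivity)
  have hΓ' : 0 < Real.Gamma ((n + 1) / 2) := Real.Gamma_pos_of_pos (by positivity)
  simp only [pow_zero, ENNReal.ofReal_one, lintegral_one, measure_univ, pow_one, Nat.cast_zero,
    add_zero, Nat.cast_one] at h0 h1
  -- The factor 1 is replaced by the zeroth moment, so that the surface mass appears on both sides.
  rw [h1, ← mul_one (ENNReal.ofReal (gaussianMeanNorm n)), h0, mul_left_comm (ENNReal.ofReal _),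
    ← ENNReal.ofReal_mul (by unfold gaussianMeanNorm; positivity)]
  congr 2
  unfold gaussianMeanNorm
  field_simp
  ring

theorem lintegral_norm_stdGaussian {n : ℕ} (hn : 1 ≤ n) :
    ∫⁻ x, ENNReal.ofReal ‖x‖ ∂(stdGaussian (EuclideanSpace ℝ (Fin n))) =
      ENNReal.ofReal (gaussianMeanNorm n) := by
  have := isProbabilityMeasure_uniformSphere hn
  rw [← map_smul_uniformSphere_prod_gaussianNormLaw hn, lintegral_map (by fun_prop) (by fun_prop),
    lintegral_prod _ (by fun_prop)]
  have : ∀ (x : Metric.sphere (0 : EuclideanSpace ℝ (Fin n)) 1) (y : Set.Ioi (0 : ℝ)),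
      ENNReal.ofReal ‖(y : ℝ) • (x : EuclideanSpace ℝ (Fin n))‖ = ENNReal.ofReal y := fun x y => by
    rw [norm_smul, norm_eq_of_mem_sphere, mul_one, Real.norm_of_nonneg y.2.le]
  simp_rw [this, lintegral_gaussianNormLaw hn]
  simp

end Polar

/-! ### Determinants under scaling and reflection. -/

section RowDet

theorem rowDet_eq_basis_det {n : ℕ} (v : Fin n → EuclideanSpace ℝ (Fin n)) :
    rowDet v = (EuclideanSpace.basisFun (Fin n) ℝ).toBasis.det v := by
  rw [Module.Basis.det_apply, ← Matrix.det_transpose]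
  rfl

@[fun_prop]
theorem continuous_rowDet {n : ℕ} :
    Continuous (rowDet : (Fin n → EuclideanSpace ℝ (Fin n)) → ℝ) := by
  unfold rowDet
  refine Continuous.matrix_det ?_
  refine continuous_matrix fun i j => ?_
  simp only [Matrix.of_apply]
  fun_prop

@[fun_prop]
theorem measurable_rowDet {n : ℕ} :
    Measurable (rowDet : (Fin n → EuclideanSpace ℝ (Fin n)) → ℝ) :=
  continuous_rowDet.measurable

theorem rowDet_smul {n : ℕ} (r : Fin n → ℝ) (v : Fin n → EuclideanSpace ℝ (Fin n)) :
    rowDet (fun i => r i • v i) = (∏ i, r i) * rowDet v := by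
  unfold rowDet
  exact Matrix.det_mul_column r (Matrix.of fun i j => v i j)

/-- A reflection is an involution, so its determinant squares to 1. -/
theorem abs_rowDet_reflection {n : ℕ} (K : Submodule ℝ (EuclideanSpace ℝ (Fin n)))
    (v : Fin n → EuclideanSpace ℝ (Fin n)) :
    |rowDet fun i => K.reflection (v i)| = |rowDet v| := by
  set Q : EuclideanSpace ℝ (Fin n) →ₗ[ℝ] EuclideanSpace ℝ (Fin n) :=
    K.reflection.toLinearEquiv.toLinearMap with hQ
  have hQQ : Q ∘ₗ Q = LinearMap.id := by
    ext1 x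
    simp [hQ]
  have hdet : LinearMap.det Q * LinearMap.det Q = 1 := by
    rw [← LinearMap.det_comp, hQQ, LinearMap.det_id]
  have habs : |LinearMap.det Q| = 1 := by
    rcases mul_self_eq_one_iff.1 hdet with h | h <;> simp [h]
  have : (fun i => K.reflection (v i)) = Q ∘ v := rfl
  rw [this, rowDet_eq_basis_det, rowDet_eq_basis_det, Module.Basis.det_comp, abs_mul, habs,
    one_mul]

/-- The vector obtained by dropping the first coordinate. -/
noncomputable def dropFirst {n : ℕ} (x : EuclideanSpace ℝ (Fin (n + 1))) :
    EuclideanSpace ℝ (Fin n) :=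
  WithLp.toLp 2 fun j => x j.succ

theorem rowDet_cons_single {n : ℕ} (a : ℝ) (y : Fin n → EuclideanSpace ℝ (Fin (n + 1))) :
    rowDet (Fin.cons (EuclideanSpace.single 0 a) y : Fin (n + 1) → EuclideanSpace ℝ (Fin (n + 1))) =
      a * rowDet fun i => dropFirst (y i) := by
  unfold rowDet
  rw [Matrix.det_succ_row_zero, Fin.sum_univ_succ, Finset.sum_eq_zero]
  · simp only [Fin.val_zero, pow_zero, one_mul, add_zero, Matrix.of_apply, Fin.cons_zero,
      PiLp.single_apply, if_true]
    congr 2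
  · intro j _
    simp

end RowDet

/-! ### Determinant of Gaussian vectors. -/

section GaussianDet

theorem measurePreserving_dropFirst (n : ℕ) :
    MeasurePreserving (dropFirst (n := n)) (stdGaussian (EuclideanSpace ℝ (Fin (n + 1))))
      (stdGaussian (EuclideanSpace ℝ (Fin n))) := by
  have hm : Measurable (dropFirst (n := n)) := by
    unfold dropFirst
    fun_prop
  refine ⟨hm, ?_⟩
  have h1 := (measurePreserving_piFinSuccAbove (fun _ : Fin (n + 1) => gaussianReal 0 1) 0)
  have h2 := measurePreserving_snd.comp h1
  rw [← map_pi_eq_stdGaussian, ← map_pi_eq_stdGaussian, ← h2.map_eq,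
    Measure.map_map hm (by fun_prop), Measure.map_map (by fun_prop) h2.measurable]
  rfl

/-- The joint law of `m` independent standard Gaussian vectors of `ℝ^n`. -/
noncomputable abbrev gaussianTuple (m n : ℕ) : Measure (Fin m → EuclideanSpace ℝ (Fin n)) :=
  Measure.pi fun _ => stdGaussian (EuclideanSpace ℝ (Fin n))

/-- A reflection sends `x` to `‖x‖` times the first basis vector and preserves the Gaussian law of
the other rows. Expanding along the first row leaves a Gaussian determinant one dimension lower. -/
theorem lintegral_abs_rowDet_cons {n : ℕ} {F : ℝ → ENNReal} (hF : Measurable F)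
    (x : EuclideanSpace ℝ (Fin (n + 1))) :
    ∫⁻ y, F |rowDet (Fin.cons x y : Fin (n + 1) → EuclideanSpace ℝ (Fin (n + 1)))|
        ∂(gaussianTuple n (n + 1)) =
      ∫⁻ y, F (‖x‖ * |rowDet y|) ∂(gaussianTuple n n) := by
  set e : EuclideanSpace ℝ (Fin (n + 1)) := EuclideanSpace.single 0 ‖x‖ with he
  have hnorm : ‖x‖ = ‖e‖ := by simp [he]
  set K := (Submodule.span ℝ {x - e})ᗮ
  have hx : K.reflection x = e := Submodule.reflection_sub hnorm
  have hQ : MeasurePreserving (fun (y : Fin n → EuclideanSpace ℝ (Fin (n + 1))) i =>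
      K.reflection (y i)) (gaussianTuple n (n + 1)) (gaussianTuple n (n + 1)) :=
    measurePreserving_pi _ _ fun _ =>
      ⟨K.reflection.continuous.measurable, stdGaussian_map K.reflection⟩
  have hD : MeasurePreserving (fun (y : Fin n → EuclideanSpace ℝ (Fin (n + 1))) i =>
      dropFirst (y i)) (gaussianTuple n (n + 1)) (gaussianTuple n n) :=
    measurePreserving_pi _ _ fun _ => measurePreserving_dropFirst n
  rw [← (hD.comp hQ).lintegral_comp (f := fun y => F (‖x‖ * |rowDet y|)) (by fun_prop)]
  refine lintegral_congr fun y => ?_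
  rw [← abs_rowDet_reflection K]
  have : (fun i => K.reflection
      ((Fin.cons x y : Fin (n + 1) → EuclideanSpace ℝ (Fin (n + 1))) i)) =
      Fin.cons e fun i => K.reflection (y i) := by
    funext i
    refine Fin.cases ?_ (fun j => ?_) i
    · simpa using hx
    · simp
  rw [this, show rowDet (Fin.cons e _) = _ from rowDet_cons_single ‖x‖ _, abs_mul, abs_norm]
  rfl

/-- `F` is arbitrary in order to serve twice: for the mean of the determinant, and as the indicator
of {0} for its almost sure nonvanishing. -/
theorem lintegral_abs_rowDet_succ (n : ℕ) {F : ℝ → ENNReal} (hF : Measurable F) :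
    ∫⁻ v, F |rowDet v| ∂(gaussianTuple (n + 1) (n + 1)) =
      ∫⁻ x, ∫⁻ y, F (‖x‖ * |rowDet y|) ∂(gaussianTuple n n)
        ∂(stdGaussian (EuclideanSpace ℝ (Fin (n + 1)))) := by
  have h := (measurePreserving_piFinSuccAbove (α := fun _ => EuclideanSpace ℝ (Fin (n + 1)))
    (fun _ : Fin (n + 1) => stdGaussian (EuclideanSpace ℝ (Fin (n + 1)))) 0).symm
  rw [← h.lintegral_comp (by fun_prop), lintegral_prod]
  · refine lintegral_congr fun x => ?_
    rw [← lintegral_abs_rowDet_cons hF x]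
    refine lintegral_congr fun y => ?_
    simp [MeasurableEquiv.piFinSuccAbove]
    rfl
  · exact ((hF.comp (measurable_rowDet.abs)).comp h.measurable).aemeasurable

/-- The mean is the product of the mean norms in dimensions 1 to n, whose Gamma quotients telescope
down to Γ(1/2) = √π. -/
theorem lintegral_abs_rowDet_gaussianTuple (n : ℕ) :
    ∫⁻ v, ENNReal.ofReal |rowDet v| ∂(gaussianTuple n n) =
      ENNReal.ofReal (Real.sqrt 2 ^ n * Real.Gamma ((n + 1) / 2) / Real.sqrt Real.pi) := by
  induction n with
  | zero =>
    have h : Real.sqrt Real.pi ≠ 0 := (Real.sqrt_pos.2 Real.pi_pos).ne'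
    have h' : Real.Gamma 2⁻¹ = Real.sqrt Real.pi := by rw [← one_div, Real.Gamma_one_half_eq]
    simp [rowDet, h', h]
  | succ n ih =>
    rw [lintegral_abs_rowDet_succ n ENNReal.measurable_ofReal]
    simp_rw [ENNReal.ofReal_mul (norm_nonneg _)]
    simp_rw [lintegral_const_mul _ (show Measurable fun v : Fin n → EuclideanSpace ℝ (Fin n) =>
      ENNReal.ofReal |rowDet v| by fun_prop), ih]
    have hΓ : 0 < Real.Gamma ((n + 1) / 2) := Real.Gamma_pos_of_pos (by positivity)
    have hΓ' : 0 < Real.Gamma ((n + 1 + 1) / 2) := Real.Gamma_pos_of_pos (by positivity)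
    rw [lintegral_mul_const _ (by fun_prop), lintegral_norm_stdGaussian (by omega),
      ← ENNReal.ofReal_mul (by unfold gaussianMeanNorm; push_cast; positivity)]
    congr 1
    unfold gaussianMeanNorm
    push_cast
    field_simp
    ring

theorem gaussianTuple_rowDet_ne_zero (n : ℕ) : ∀ᵐ v ∂(gaussianTuple n n), rowDet v ≠ 0 := by
  induction n with
  | zero => simp [rowDet]
  | succ n ih =>
    let F : ℝ → ENNReal := Set.indicator {0} 1
    have hF : Measurable F := measurable_one.indicator (measurableSet_singleton 0)
    have h := lintegral_abs_rowDet_succ n hF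
    have hnull : ∀ᵐ x ∂(stdGaussian (EuclideanSpace ℝ (Fin (n + 1)))), x ≠ 0 := by
      rw [stdGaussian_eq_withDensity]
      exact (withDensity_absolutelyContinuous _ _).ae_le (Measure.ae_ne volume 0)
    have hzero : ∫⁻ x, ∫⁻ y, F (‖x‖ * |rowDet y|) ∂(gaussianTuple n n)
        ∂(stdGaussian (EuclideanSpace ℝ (Fin (n + 1)))) = 0 := by
      rw [lintegral_eq_zero_iff' (by fun_prop)]
      filter_upwards [hnull] with x hx
      rw [Pi.zero_apply, lintegral_eq_zero_iff (by fun_prop)]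
      filter_upwards [ih] with y hy
      simp [F, hx, hy]
    rw [hzero, lintegral_eq_zero_iff (by fun_prop)] at h
    filter_upwards [h] with v hv hv0
    simp [F, hv0] at hv

end GaussianDet

/-! ### Determinant of uniform points of the sphere. -/

section SphereDet

theorem measurePreserving_smul_pi {n : ℕ} (hn : 1 ≤ n) (m : ℕ) :
    MeasurePreserving
      (fun (p : (Fin m → Metric.sphere (0 : EuclideanSpace ℝ (Fin n)) 1) ×
        (Fin m → Set.Ioi (0 : ℝ))) i => (p.2 i : ℝ) • (p.1 i : EuclideanSpace ℝ (Fin n)))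
      ((Measure.pi fun _ => uniformSphere n).prod (Measure.pi fun _ => gaussianNormLaw n))
      (gaussianTuple m n) := by
  have := isProbabilityMeasure_uniformSphere hn
  have := isProbabilityMeasure_gaussianNormLaw hn
  have h1 := (measurePreserving_arrowProdEquivProdArrow
    (Metric.sphere (0 : EuclideanSpace ℝ (Fin n)) 1) (Set.Ioi (0 : ℝ)) (Fin m)
    (fun _ => uniformSphere n) (fun _ => gaussianNormLaw n)).symm
  have h2 := measurePreserving_pi (fun _ : Fin m => (uniformSphere n).prod (gaussianNormLaw n))
    (fun _ => stdGaussian (EuclideanSpace ℝ (Fin n)))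
    (f := fun _ p => (p.2 : ℝ) • (p.1 : EuclideanSpace ℝ (Fin n)))
    fun _ => ⟨by fun_prop, map_smul_uniformSphere_prod_gaussianNormLaw hn⟩
  exact h2.comp h1

/-- By Fubini, almost every tuple of directions admits radii for which the Gaussian determinant is
nonzero, and the radii only scale the determinant. -/
theorem uniformSphere_rowDet_ne_zero {n : ℕ} (hn : 1 ≤ n) :
    ∀ᵐ u ∂(Measure.pi fun _ : Fin n => uniformSphere n),
      rowDet (fun i => (u i : EuclideanSpace ℝ (Fin n))) ≠ 0 := by
  have := isProbabilityMeasure_uniformSphere hn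
  have := isProbabilityMeasure_gaussianNormLaw hn
  have h := (measurePreserving_smul_pi hn n).quasiMeasurePreserving.ae
    (gaussianTuple_rowDet_ne_zero n)
  have h' := Measure.ae_ae_of_ae_prod h
  filter_upwards [h'] with u hu
  obtain ⟨r, hr⟩ := hu.exists
  intro h0
  apply hr
  rw [rowDet_smul (fun i => (r i : ℝ)), h0, mul_zero]

theorem lintegral_prod_pi {ι α : Type*} [Fintype ι] [MeasurableSpace α] (μ : Measure α)
    [IsProbabilityMeasure μ] {f : α → ENNReal} (hf : Measurable f) :
    ∫⁻ x, ∏ i, f (x i) ∂(Measure.pi fun _ : ι => μ) = (∫⁻ a, f a ∂μ) ^ Fintype.card ι := by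
  rw [lintegral_prod_eq_prod_lintegral_of_indepFun Finset.univ (fun i (x : ι → α) => f (x i))
    (iIndepFun_pi fun _ => hf.aemeasurable) fun i => by fun_prop]
  have : ∀ i : ι, ∫⁻ x, f (x i) ∂(Measure.pi fun _ : ι => μ) = ∫⁻ a, f a ∂μ := fun i =>
    (measurePreserving_eval (fun _ : ι => μ) i).lintegral_comp hf
  simp [this]

/-- The expected absolute determinant of `n` independent uniform points of the unit sphere. -/
theorem lintegral_abs_rowDet_uniformSphere {n : ℕ} (hn : 1 ≤ n) :
    ∫⁻ u, ENNReal.ofReal |rowDet fun i => (u i : EuclideanSpace ℝ (Fin n))|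
        ∂(Measure.pi fun _ : Fin n => uniformSphere n) =
      ENNReal.ofReal (Real.Gamma (n / 2) ^ n /
        (Real.sqrt Real.pi * Real.Gamma ((n + 1) / 2) ^ (n - 1))) := by
  have := isProbabilityMeasure_uniformSphere hn
  have := isProbabilityMeasure_gaussianNormLaw hn
  have hn' : (0 : ℝ) < n := by exact_mod_cast hn
  have hΓ : 0 < Real.Gamma (n / 2) := Real.Gamma_pos_of_pos (by positivity)
  have hΓ' : 0 < Real.Gamma ((n + 1) / 2) := Real.Gamma_pos_of_pos (by positivity)
  have hκ : 0 < gaussianMeanNorm n := by unfold gaussianMeanNorm; positivity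
  set D := ∫⁻ u, ENNReal.ofReal |rowDet fun i => (u i : EuclideanSpace ℝ (Fin n))|
        ∂(Measure.pi fun _ : Fin n => uniformSphere n)
  have hJ := lintegral_abs_rowDet_gaussianTuple n
  have hmeas : Measurable fun u : Fin n → Metric.sphere (0 : EuclideanSpace ℝ (Fin n)) 1 =>
      rowDet fun i => (u i : EuclideanSpace ℝ (Fin n)) := measurable_rowDet.comp (by fun_prop)
  -- The radii factor out of the determinant and are independent of the directions.
  have hsplit : ∫⁻ v, ENNReal.ofReal |rowDet v| ∂(gaussianTuple n n) =
      D * ENNReal.ofReal (gaussianMeanNorm n) ^ n := by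
    rw [← (measurePreserving_smul_pi hn n).lintegral_comp (by fun_prop)]
    have : ∀ p : (Fin n → Metric.sphere (0 : EuclideanSpace ℝ (Fin n)) 1) ×
        (Fin n → Set.Ioi (0 : ℝ)),
        ENNReal.ofReal |rowDet fun i => (p.2 i : ℝ) • (p.1 i : EuclideanSpace ℝ (Fin n))| =
          ENNReal.ofReal |rowDet fun i => (p.1 i : EuclideanSpace ℝ (Fin n))| *
            ∏ i, ENNReal.ofReal (p.2 i) := by
      intro p
      have hp : 0 ≤ ∏ i, (p.2 i : ℝ) := Finset.prod_nonneg fun i _ => (p.2 i).2.le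
      rw [rowDet_smul (fun i => (p.2 i : ℝ)), abs_mul, abs_of_nonneg hp, mul_comm,
        ENNReal.ofReal_mul (abs_nonneg _),
        ENNReal.ofReal_prod_of_nonneg fun i _ => (p.2 i).2.le]
    simp_rw [this]
    rw [lintegral_prod_mul (f := fun u : Fin n → Metric.sphere (0 : EuclideanSpace ℝ (Fin n)) 1 =>
        ENNReal.ofReal |rowDet fun i => (u i : EuclideanSpace ℝ (Fin n))|)
        (g := fun r : Fin n → Set.Ioi (0 : ℝ) => ∏ i, ENNReal.ofReal (r i))
        (hmeas.abs.ennreal_ofReal.aemeasurable)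
        (Measurable.aemeasurable (by fun_prop)),
      lintegral_prod_pi _ (f := fun r : Set.Ioi (0 : ℝ) => ENNReal.ofReal r) (by fun_prop),
      lintegral_gaussianNormLaw hn, Fintype.card_fin]
  rw [hsplit, ← ENNReal.ofReal_pow hκ.le] at hJ
  have hκn : 0 < gaussianMeanNorm n ^ n := by positivity
  rw [mul_comm, ← ENNReal.eq_div_iff (by simpa using hκn) ENNReal.ofReal_ne_top,
    ← ENNReal.ofReal_div_of_pos hκn] at hJ
  rw [hJ]
  congr 1
  obtain ⟨m, rfl⟩ := Nat.exists_eq_add_of_le' hn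
  rw [gaussianMeanNorm, Nat.add_sub_cancel, div_pow, mul_pow]
  field_simp
  ring

end SphereDet

/-! ### Geometry of a fixed configuration and its sign changes. -/

section Configurations

variable {d : ℕ}

/-- The determinant of the vectors `u 1, …, u d`. -/
noncomputable def baseDet (u : Fin (d + 1) → EuclideanSpace ℝ (Fin d)) : ℝ :=
  rowDet fun i => u i.succ

/-- The determinant of the vectors `u 1, …, u d`, the one of index `i + 1` being replaced
by `u 0`. -/
noncomputable def replacedDet (u : Fin (d + 1) → EuclideanSpace ℝ (Fin d)) (i : Fin d) : ℝ :=
  rowDet (Function.update (fun i => u i.succ) i (u 0))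

/-- All the determinants `replacedDet u i` have the same strict sign. -/
def SameSign (u : Fin (d + 1) → EuclideanSpace ℝ (Fin d)) : Prop :=
  (∀ i, 0 < replacedDet u i) ∨ ∀ i, replacedDet u i < 0

/-- Cramer's rule, in the division-free form valid for every configuration. -/
theorem sum_replacedDet_smul (u : Fin (d + 1) → EuclideanSpace ℝ (Fin d)) :
    ∑ i, replacedDet u i • u i.succ = baseDet u • u 0 := by
  let A : Matrix (Fin d) (Fin d) ℝ := Matrix.of fun i j => u i.succ j
  have h := A.transpose.mulVec_cramer (u 0)
  have hc : ∀ i, A.transpose.cramer (u 0) i = replacedDet u i := fun i => by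
    rw [Matrix.cramer_transpose_apply, replacedDet, rowDet]
    congr 1
    ext k j
    by_cases hk : k = i
    · subst hk; simp
    · simp [A, hk]
  ext j
  have hj := congrFun h j
  simp only [Matrix.mulVec, dotProduct, hc, Matrix.det_transpose, Pi.smul_apply, smul_eq_mul,
    Matrix.transpose_apply] at hj
  simp only [WithLp.ofLp_sum, WithLp.ofLp_smul, Finset.sum_apply, Pi.smul_apply, smul_eq_mul]
  rw [show baseDet u = A.det from rfl, ← hj]
  exact Finset.sum_congr rfl fun i _ => mul_comm _ _

theorem eq_zero_of_sum_smul_eq_zero {v : Fin d → EuclideanSpace ℝ (Fin d)} (hv : rowDet v ≠ 0)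
    {c : Fin d → ℝ} (hc : ∑ i, c i • v i = 0) (i : Fin d) : c i = 0 := by
  have := Matrix.eq_zero_of_vecMul_eq_zero (M := Matrix.of fun i j => v i j) hv (v := c) ?_
  · exact congrFun this i
  · ext j
    have := congrArg (fun x : EuclideanSpace ℝ (Fin d) => x j) hc
    simpa [Matrix.vecMul, dotProduct] using this

/-- Subtracting `u 0` from every row is a rank-one update, so the matrix determinant lemma applies.
Cramer's rule identifies the row `u 0` times the inverse matrix with the replaced determinants
divided by `baseDet u`. -/
theorem rowDet_sub {u : Fin (d + 1) → EuclideanSpace ℝ (Fin d)} (hu : baseDet u ≠ 0) :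
    (rowDet fun i => u i.succ - u 0) = baseDet u - ∑ i, replacedDet u i := by
  let A : Matrix (Fin d) (Fin d) ℝ := Matrix.of fun i j => u i.succ j
  have hA : IsUnit A.det := isUnit_iff_ne_zero.2 hu
  have h := Matrix.det_add_replicateCol_mul_replicateRow (ι := Unit) hA (fun _ => -1) (u 0)
  have hrow : (fun i => replacedDet u i) = baseDet u • Matrix.vecMul (u 0) A⁻¹ := by
    have h1 : Matrix.vecMul (fun i => replacedDet u i) A = baseDet u • (u 0 : Fin d → ℝ) := by
      ext j
      have := congrArg (fun x : EuclideanSpace ℝ (Fin d) => x j) (sum_replacedDet_smul u)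
      simpa [Matrix.vecMul, dotProduct, A] using this
    rw [← Matrix.smul_vecMul, ← h1, Matrix.vecMul_vecMul, Matrix.mul_nonsing_inv _ hA,
      Matrix.vecMul_one]
  have hsum : ∑ i, replacedDet u i = baseDet u * ∑ i, Matrix.vecMul (u 0) A⁻¹ i := by
    rw [Finset.mul_sum]
    exact Finset.sum_congr rfl fun i _ => congrFun hrow i
  have hL : A + Matrix.replicateCol Unit (fun _ : Fin d => (-1 : ℝ)) * Matrix.replicateRow Unit (u 0) =
      Matrix.of fun i j => (u i.succ - u 0) j := by
    ext i j
    simp [A, Matrix.mul_apply, sub_eq_add_neg]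
  rw [hL] at h
  rw [rowDet, h, hsum, show baseDet u = A.det from rfl, Matrix.det_unique (n := Unit)]
  simp only [Matrix.add_apply, Matrix.one_apply_eq, Matrix.mul_apply, Matrix.replicateCol_apply,
    Matrix.replicateRow_apply, mul_neg, mul_one, Finset.sum_neg_distrib, Matrix.vecMul, dotProduct]
  ring

theorem abs_baseDet_le {u : Fin (d + 1) → EuclideanSpace ℝ (Fin d)} (hu : ∀ i, ‖u i‖ = 1) :
    |baseDet u| ≤ ∑ i, |replacedDet u i| := by
  have h := congrArg norm (sum_replacedDet_smul u)
  rw [norm_smul, hu, mul_one, Real.norm_eq_abs] at h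
  rw [← h]
  refine (norm_sum_le _ _).trans_eq (Finset.sum_congr rfl fun i _ => ?_)
  rw [norm_smul, hu, mul_one, Real.norm_eq_abs]

/-- If weights `w` annihilate the projections, then ∑ w_i u_i = c u_0 for some c. Comparing with
Cramer's rule through linear independence gives `w i * baseDet u = c * replacedDet u i`, so
nonnegative weights force a common sign. -/
theorem sameSign_of_mem_hullConfigurations {u : Fin (d + 1) → EuclideanSpace ℝ (Fin d)}
    (hu : baseDet u ≠ 0) (hu' : ∀ i, replacedDet u i ≠ 0) (h : u ∈ hullConfigurations d) :
    SameSign u := by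
  obtain ⟨w, hw0, hw1, hw⟩ := exists_weights_of_mem_convexHull_range h
  simp_rw [← map_smul, ← map_sum] at hw
  have hmem : ∑ i, w i • u i.succ ∈ Submodule.span ℝ {u 0} := by
    have := (Submodule.starProjection_apply_eq_zero_iff _).1 hw
    rwa [Submodule.orthogonal_orthogonal] at this
  obtain ⟨c, hc⟩ := Submodule.mem_span_singleton.1 hmem
  have hprop : ∀ i, w i * baseDet u = c * replacedDet u i := fun i => by
    refine sub_eq_zero.1 (eq_zero_of_sum_smul_eq_zero (v := fun i => u i.succ)
      (c := fun i => w i * baseDet u - c * replacedDet u i) hu ?_ i)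
    simp_rw [sub_smul, Finset.sum_sub_distrib, mul_comm _ (baseDet u), mul_smul]
    rw [← Finset.smul_sum, ← Finset.smul_sum, sum_replacedDet_smul, ← hc, smul_comm, sub_self]
  have hc0 : c ≠ 0 := by
    rintro rfl
    have : ∀ i, w i = 0 := fun i => by simpa [hu] using hprop i
    simp [this] at hw1
  have hw' : ∀ i, 0 < c / baseDet u * replacedDet u i := fun i => by
    have : c / baseDet u * replacedDet u i = w i := by
      rw [div_mul_eq_mul_div, ← hprop, mul_div_cancel_right₀ _ hu]
    rw [this]
    refine (hw0 i).lt_of_ne' fun h0 => ?_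
    have := hprop i
    rw [h0, zero_mul, eq_comm, mul_eq_zero] at this
    exact this.elim hc0 (hu' i)
  rcases lt_or_gt_of_ne (div_ne_zero hc0 hu) with hneg | hpos
  · exact Or.inr fun i => by nlinarith [hw' i]
  · exact Or.inl fun i => by simpa [hpos] using hw' i

/-- Normalising the determinants by their sum gives strictly positive weights annihilating the
projections. -/
theorem mem_relintConfigurations_of_sameSign (hd : 1 ≤ d)
    {u : Fin (d + 1) → EuclideanSpace ℝ (Fin d)} (h : SameSign u) :
    u ∈ relintConfigurations d := by
  have hne : (Finset.univ : Finset (Fin d)).Nonempty := ⟨⟨0, hd⟩, Finset.mem_univ _⟩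
  set s := ∑ i, replacedDet u i with hs
  have hpos : ∀ i, 0 < replacedDet u i / s := by
    rcases h with h | h
    · exact fun i => div_pos (h i) (Finset.sum_pos (fun j _ => h j) hne)
    · exact fun i => div_pos_of_neg_of_neg (h i) (Finset.sum_neg (fun j _ => h j) hne)
  have hs0 : s ≠ 0 := fun h0 => by
    have := hpos ⟨0, hd⟩
    simp [h0] at this
  have hmem := sum_smul_mem_intrinsicInterior_convexHull
    (fun i : Fin d => (Submodule.span ℝ {u 0})ᗮ.starProjection (u i.succ)) _ hpos
    (by rw [← Finset.sum_div, div_self hs0])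
  have hzero : ∑ i, (replacedDet u i / s) • (Submodule.span ℝ {u 0})ᗮ.starProjection (u i.succ) =
      0 := by
    simp_rw [← map_smul, ← map_sum, div_eq_inv_mul, mul_smul, ← Finset.smul_sum,
      sum_replacedDet_smul, map_smul]
    rw [(Submodule.starProjection_apply_eq_zero_iff _).2, smul_zero, smul_zero]
    rw [Submodule.orthogonal_orthogonal]
    exact Submodule.mem_span_singleton_self _
  rwa [hzero] at hmem

theorem relintConfigurations_subset_hullConfigurations :
    relintConfigurations d ⊆ hullConfigurations d :=
  fun u h => intrinsicInterior_subset (s := convexHull ℝ (projectedPoints u)) h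

open Classical in
/-- The volume of the simplex, restricted to the configurations of constant sign, for
configurations in general position. -/
noncomputable def signedVolume (u : Fin (d + 1) → EuclideanSpace ℝ (Fin d)) : ℝ :=
  if SameSign u then |baseDet u - ∑ i, replacedDet u i| / d.factorial else 0

/-- Allowing any `S` between the two sets of configurations treats both meanings of Conv at once. -/
theorem indicator_simplexVolume_eq (hd : 1 ≤ d)
    {S : Set (Fin (d + 1) → EuclideanSpace ℝ (Fin d))} (hS : relintConfigurations d ⊆ S)
    (hS' : S ⊆ hullConfigurations d) {u : Fin (d + 1) → EuclideanSpace ℝ (Fin d)}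
    (hu : baseDet u ≠ 0) (hu' : ∀ i, replacedDet u i ≠ 0) :
    S.indicator simplexVolume u = signedVolume u := by
  by_cases h : SameSign u
  · rw [signedVolume, if_pos h, Set.indicator_of_mem
      (hS (mem_relintConfigurations_of_sameSign hd h)), simplexVolume_eq, rowDet_sub hu]
  · rw [signedVolume, if_neg h, Set.indicator_of_notMem]
    exact fun hm => h (sameSign_of_mem_hullConfigurations hu hu' (hS' hm))

/-- The configuration obtained by multiplying `u 1, …, u d` by signs. -/
noncomputable def flipTail (ε : Fin d → ℤˣ) (u : Fin (d + 1) → EuclideanSpace ℝ (Fin d)) :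
    Fin (d + 1) → EuclideanSpace ℝ (Fin d) :=
  Fin.cons (u 0) fun i => ((ε i : ℤ) : ℝ) • u i.succ

theorem intUnit_cast_mul_self (e : ℤˣ) : ((e : ℤ) : ℝ) * ((e : ℤ) : ℝ) = 1 := by
  rcases Int.units_eq_one_or e with h | h <;> simp [h]

theorem baseDet_flipTail (ε : Fin d → ℤˣ) (u : Fin (d + 1) → EuclideanSpace ℝ (Fin d)) :
    baseDet (flipTail ε u) = (∏ i, ((ε i : ℤ) : ℝ)) * baseDet u := by
  simp only [baseDet, flipTail, Fin.cons_succ]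
  exact rowDet_smul _ _

theorem replacedDet_flipTail (ε : Fin d → ℤˣ) (u : Fin (d + 1) → EuclideanSpace ℝ (Fin d))
    (i : Fin d) :
    replacedDet (flipTail ε u) i =
      (∏ i, ((ε i : ℤ) : ℝ)) * (((ε i : ℤ) : ℝ) * replacedDet u i) := by
  have h : Function.update (fun j => flipTail ε u (Fin.succ j)) i (flipTail ε u 0) =
      fun j => Function.update (fun j => ((ε j : ℤ) : ℝ)) i 1 j •
        Function.update (fun j => u (Fin.succ j)) i (u 0) j := by
    funext j
    by_cases hj : j = i
    · subst hj; simp [flipTail]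
    · simp [flipTail, hj]
  rw [replacedDet, h, rowDet_smul, ← mul_assoc, replacedDet]
  congr 1
  -- The row `i` holds `u 0`, which takes no sign, so `ε i` is missing from the product. It is
  -- restored using `ε i * ε i = 1`.
  rw [Finset.prod_update_of_mem (Finset.mem_univ i), one_mul,
    ← Finset.mul_prod_erase Finset.univ _ (Finset.mem_univ i), Finset.sdiff_singleton_eq_erase,
    mul_right_comm, intUnit_cast_mul_self, one_mul]

theorem sum_signedVolume_flipTail (hd : 1 ≤ d) {u : Fin (d + 1) → EuclideanSpace ℝ (Fin d)}
    (hu' : ∀ i, replacedDet u i ≠ 0) (hnorm : ∀ i, ‖u i‖ = 1) :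
    ∑ ε : Fin d → ℤˣ, signedVolume (flipTail ε u) =
      2 / d.factorial * ∑ i, |replacedDet u i| := by
  classical
  -- The signs of the replaced determinants: only `η` and `-η` make them all agree after flipping.
  set η : Fin d → ℤˣ := fun i => if 0 < replacedDet u i then 1 else -1 with hη
  have hηabs : ∀ i, ((η i : ℤ) : ℝ) * replacedDet u i = |replacedDet u i| := fun i => by
    by_cases h : 0 < replacedDet u i
    · simp [hη, h, abs_of_pos h]
    · simp [hη, h, abs_of_nonpos (not_lt.1 h)]
  have habs : ∀ i, 0 < |replacedDet u i| := fun i => abs_pos.2 (hu' i)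
  have hpos_iff : ∀ (e : ℤˣ) i, 0 < ((e : ℤ) : ℝ) * replacedDet u i ↔ e = η i := fun e i => by
    have h1 := hηabs i
    have h2 := habs i
    rcases Int.units_eq_one_or e with h | h <;> rcases Int.units_eq_one_or (η i) with h' | h' <;>
      simp only [h, h', Units.val_one, Units.val_neg, Int.cast_one, Int.cast_neg] at h1 ⊢ <;>
      simp <;> linarith
  have hneg_iff : ∀ (e : ℤˣ) i, ((e : ℤ) : ℝ) * replacedDet u i < 0 ↔ e = -η i := fun e i => by
    rw [← neg_eq_iff_eq_neg, ← hpos_iff]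
    simp
  have hprod : ∀ ε : Fin d → ℤˣ, (∏ i, ((ε i : ℤ) : ℝ)) = 1 ∨ (∏ i, ((ε i : ℤ) : ℝ)) = -1 :=
    fun ε => by
      rcases Int.units_eq_one_or (∏ i, ε i) with h | h
      · left
        simpa [Units.coe_prod] using congrArg (fun e : ℤˣ => ((e : ℤ) : ℝ)) h
      · right
        simpa [Units.coe_prod] using congrArg (fun e : ℤˣ => ((e : ℤ) : ℝ)) h
  have hsame : ∀ ε, SameSign (flipTail ε u) ↔ ε = η ∨ ε = -η := fun ε => by
    simp only [SameSign, replacedDet_flipTail]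
    rcases hprod ε with h | h
    · simp only [h, one_mul, hpos_iff, hneg_iff, funext_iff, Pi.neg_apply]
    · simp only [h, neg_one_mul, neg_pos, neg_lt_zero, hpos_iff, hneg_iff, funext_iff,
        Pi.neg_apply]
      exact or_comm
  have hvalue : ∀ ε : Fin d → ℤˣ, signedVolume (flipTail ε u) =
      if ε = η ∨ ε = -η then
        |baseDet u - ∑ i, ((ε i : ℤ) : ℝ) * replacedDet u i| / d.factorial else 0 := fun ε => by
    rw [signedVolume]
    refine if_congr (hsame ε) ?_ rfl
    simp_rw [replacedDet_flipTail, baseDet_flipTail, ← Finset.mul_sum, ← mul_sub, abs_mul]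
    rcases hprod ε with h | h <;> simp [h]
  -- This needs a coordinate: for d = 0 the two sign vectors would coincide.
  have hne : η ≠ -η := fun h => by
    have := congrFun h ⟨0, hd⟩
    rcases Int.units_eq_one_or (η ⟨0, hd⟩) with h' | h' <;> simp [h'] at this
  have hle := abs_le.1 (abs_baseDet_le hnorm)
  simp_rw [hvalue]
  rw [← Finset.sum_filter, show Finset.univ.filter (fun ε => ε = η ∨ ε = -η) = {η, -η} by
    ext; simp, Finset.sum_pair hne]
  simp only [Pi.neg_apply, Units.val_neg, Int.cast_neg, neg_mul, Finset.sum_neg_distrib,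
    sub_neg_eq_add, hηabs]
  -- The bound `abs_baseDet_le` fixes both signs, and `baseDet u` cancels between the two volumes.
  rw [abs_of_nonpos (by linarith), abs_of_nonneg (by linarith)]
  ring

end Configurations

/-! ### Symmetries of the uniform law on the sphere. -/

section SphereSymmetry

open scoped Pointwise in
/-- The surface measure of the unit sphere is invariant under the antipodal map. -/
theorem toSphere_map_neg {E : Type*} [NormedAddCommGroup E] [NormedSpace ℝ E] [MeasurableSpace E]
    [BorelSpace E] (μ : Measure E) [μ.IsNegInvariant] :
    μ.toSphere.map (fun x => -x) = μ.toSphere := by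
  have hneg : Measurable fun x : Metric.sphere (0 : E) 1 => -x := continuous_neg.measurable
  ext s hs
  rw [Measure.map_apply hneg hs, Measure.toSphere_apply' _ (hneg hs), Measure.toSphere_apply' _ hs]
  congr 1
  rw [← Measure.measure_neg μ (Set.Ioo (0 : ℝ) 1 • (((↑) : Metric.sphere (0 : E) 1 → E) '' s))]
  congr 1
  ext y
  simp only [Set.mem_smul, Set.mem_neg]
  constructor
  · rintro ⟨r, hr, _, ⟨x, hx, rfl⟩, rfl⟩
    exact ⟨r, hr, _, ⟨-x, hx, rfl⟩, by simp⟩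
  · rintro ⟨r, hr, _, ⟨x, hx, rfl⟩, h⟩
    exact ⟨r, hr, _, ⟨-x, by simpa using hx, rfl⟩, by simp [h]⟩

/-- Multiplication of a point of the unit sphere by a sign. -/
noncomputable def sphereSign {n : ℕ} (e : ℤˣ) (x : Metric.sphere (0 : EuclideanSpace ℝ (Fin n)) 1) :
    Metric.sphere (0 : EuclideanSpace ℝ (Fin n)) 1 :=
  if e = 1 then x else -x

theorem coe_sphereSign {n : ℕ} (e : ℤˣ) (x : Metric.sphere (0 : EuclideanSpace ℝ (Fin n)) 1) :
    (sphereSign e x : EuclideanSpace ℝ (Fin n)) = ((e : ℤ) : ℝ) • (x : EuclideanSpace ℝ (Fin n)) := by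
  rcases Int.units_eq_one_or e with h | h <;> simp [sphereSign, h]

theorem measurePreserving_sphereSign {n : ℕ} (e : ℤˣ) :
    MeasurePreserving (sphereSign (n := n) e) (uniformSphere n) (uniformSphere n) := by
  rcases Int.units_eq_one_or e with h | h
  · have : sphereSign (n := n) e = id := by
      funext x
      simp [sphereSign, h]
    rw [this]
    exact MeasurePreserving.id _
  · have : sphereSign (n := n) e = fun x => -x := by
      funext x
      simp [sphereSign, h]
    rw [this]
    refine ⟨continuous_neg.measurable, ?_⟩
    rw [uniformSphere, Measure.map_smul, toSphere_map_neg]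

theorem measurePreserving_pi_comp {ι κ α : Type*} [Fintype ι] [Fintype κ] [MeasurableSpace α]
    (μ : Measure α) [IsProbabilityMeasure μ] {g : κ → ι} (hg : Function.Injective g) :
    MeasurePreserving (fun (u : ι → α) k => u (g k)) (Measure.pi fun _ => μ)
      (Measure.pi fun _ => μ) := by
  have hind : iIndepFun (fun i (u : ι → α) => u i) (Measure.pi fun _ => μ) :=
    iIndepFun_pi (X := fun _ => id) fun _ => aemeasurable_id
  refine ⟨by fun_prop, ?_⟩
  exact ((hind.precomp hg).hasLaw_pi
    fun k => (measurePreserving_eval (fun _ : ι => μ) (g k)).hasLaw).map_eq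

end SphereSymmetry

/-! ### Averaging over signs, the closed form and the recursion. -/

section Expectation

variable {d : ℕ}

/-- The joint law of `m` independent uniform points of the unit sphere of `ℝ^d`. -/
noncomputable abbrev sphereTuple (m d : ℕ) :
    Measure (Fin m → Metric.sphere (0 : EuclideanSpace ℝ (Fin d)) 1) :=
  Measure.pi fun _ => uniformSphere d

/-- Replacing a vector by `u 0` amounts to selecting other indices injectively, so each replaced
determinant has the law of the determinant of d independent uniform points. -/
theorem replacedDet_coe (u : Fin (d + 1) → Metric.sphere (0 : EuclideanSpace ℝ (Fin d)) 1)
    (i : Fin d) :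
    replacedDet (fun k => (u k : EuclideanSpace ℝ (Fin d))) i =
      rowDet fun j => (u (Function.update Fin.succ i 0 j) : EuclideanSpace ℝ (Fin d)) := by
  rw [replacedDet]
  congr 1
  funext j
  by_cases h : j = i
  · subst h; simp
  · simp [h]

theorem injective_update_succ (i : Fin d) :
    Function.Injective (Function.update Fin.succ i 0 : Fin d → Fin (d + 1)) := by
  intro j k h
  by_cases hj : j = i <;> by_cases hk : k = i
  · rw [hj, hk]
  · subst hj
    simp [hk, (Fin.succ_ne_zero k).symm] at h
  · subst hk
    simp [hj, Fin.succ_ne_zero] at h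
  · simpa [hj, hk] using h

theorem sphereTuple_generic (hd : 1 ≤ d) :
    ∀ᵐ u ∂(sphereTuple (d + 1) d),
      baseDet (fun k => (u k : EuclideanSpace ℝ (Fin d))) ≠ 0 ∧
        ∀ i, replacedDet (fun k => (u k : EuclideanSpace ℝ (Fin d))) i ≠ 0 := by
  have := isProbabilityMeasure_uniformSphere hd
  have h := uniformSphere_rowDet_ne_zero hd
  refine Filter.Eventually.and ?_ (ae_all_iff.2 fun i => ?_)
  · exact (measurePreserving_pi_comp (uniformSphere d)
      (Fin.succ_injective d)).quasiMeasurePreserving.ae h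
  · simp_rw [replacedDet_coe]
    exact (measurePreserving_pi_comp (uniformSphere d)
      (injective_update_succ i)).quasiMeasurePreserving.ae h

theorem continuous_baseDet :
    Continuous (baseDet : (Fin (d + 1) → EuclideanSpace ℝ (Fin d)) → ℝ) :=
  continuous_rowDet.comp (by fun_prop)

theorem continuous_replacedDet (i : Fin d) :
    Continuous fun u : Fin (d + 1) → EuclideanSpace ℝ (Fin d) => replacedDet u i :=
  continuous_rowDet.comp
    (Continuous.update (f := fun (u : Fin (d + 1) → EuclideanSpace ℝ (Fin d)) (j : Fin d) => u j.succ)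
      (by fun_prop) i (by fun_prop))

theorem measurable_signedVolume :
    Measurable (signedVolume : (Fin (d + 1) → EuclideanSpace ℝ (Fin d)) → ℝ) := by
  classical
  have hbase : Measurable (baseDet : (Fin (d + 1) → EuclideanSpace ℝ (Fin d)) → ℝ) :=
    continuous_baseDet.measurable
  have hrepl : ∀ i, Measurable fun u : Fin (d + 1) → EuclideanSpace ℝ (Fin d) =>
      replacedDet u i := fun i => (continuous_replacedDet i).measurable
  have hset : MeasurableSet {u : Fin (d + 1) → EuclideanSpace ℝ (Fin d) | SameSign u} := by
    simp only [SameSign, Set.ofPred_or, Set.ofPred_forall]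
    exact (MeasurableSet.iInter fun i => measurableSet_lt measurable_const (hrepl i)).union
      (MeasurableSet.iInter fun i => measurableSet_lt (hrepl i) measurable_const)
  unfold signedVolume
  exact Measurable.ite hset (by fun_prop) measurable_const

theorem signedVolume_nonneg (u : Fin (d + 1) → EuclideanSpace ℝ (Fin d)) :
    0 ≤ signedVolume u := by
  unfold signedVolume
  split_ifs <;> positivity

theorem lintegral_signedVolume_flipTail (hd : 1 ≤ d) (ε : Fin d → ℤˣ) :
    ∫⁻ u, ENNReal.ofReal (signedVolume (flipTail ε fun k => (u k : EuclideanSpace ℝ (Fin d))))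
        ∂(sphereTuple (d + 1) d) =
      ∫⁻ u, ENNReal.ofReal (signedVolume fun k => (u k : EuclideanSpace ℝ (Fin d)))
        ∂(sphereTuple (d + 1) d) := by
  have := isProbabilityMeasure_uniformSphere hd
  have hmp := measurePreserving_pi (fun _ : Fin (d + 1) => uniformSphere d)
    (fun _ => uniformSphere d)
    fun i => measurePreserving_sphereSign ((Fin.cons 1 ε : Fin (d + 1) → ℤˣ) i)
  have hmeas : Measurable fun u : Fin (d + 1) → Metric.sphere (0 : EuclideanSpace ℝ (Fin d)) 1 =>
      ENNReal.ofReal (signedVolume fun k => (u k : EuclideanSpace ℝ (Fin d))) :=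
    (measurable_signedVolume.comp (by fun_prop)).ennreal_ofReal
  rw [← hmp.lintegral_comp hmeas]
  refine lintegral_congr fun u => ?_
  congr 2
  funext k
  refine Fin.cases ?_ (fun j => ?_) k <;> simp [flipTail, coe_sphereSign]

/-- The value of the expectation in dimension `d`. -/
noncomputable def expectedVolume (d : ℕ) : ℝ :=
  Real.Gamma ((d : ℝ) / 2) ^ d
          / (2 ^ (d - 1) * Real.sqrt Real.pi * ((d - 1).factorial : ℝ)
              * Real.Gamma (((d : ℝ) + 1) / 2) ^ (d - 1))

theorem expectedVolume_nonneg (d : ℕ) : 0 ≤ expectedVolume d := by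
  have h1 : 0 ≤ Real.Gamma ((d : ℝ) / 2) := Real.Gamma_nonneg_of_nonneg (by positivity)
  have h2 : 0 ≤ Real.Gamma (((d : ℝ) + 1) / 2) := Real.Gamma_nonneg_of_nonneg (by positivity)
  unfold expectedVolume
  positivity

theorem lintegral_signedVolume (hd : 1 ≤ d) :
    ∫⁻ u, ENNReal.ofReal (signedVolume fun k => (u k : EuclideanSpace ℝ (Fin d)))
        ∂(sphereTuple (d + 1) d) = ENNReal.ofReal (expectedVolume d) := by
  have := isProbabilityMeasure_uniformSphere hd
  set L := ∫⁻ u, ENNReal.ofReal (signedVolume fun k => (u k : EuclideanSpace ℝ (Fin d)))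
        ∂(sphereTuple (d + 1) d)
  set D := Real.Gamma (d / 2) ^ d / (Real.sqrt Real.pi * Real.Gamma ((d + 1) / 2) ^ (d - 1)) with hD
  have hΓ : 0 < Real.Gamma ((d : ℝ) / 2) :=
    Real.Gamma_pos_of_pos (div_pos (by exact_mod_cast hd) two_pos)
  have hΓ' : 0 < Real.Gamma (((d : ℝ) + 1) / 2) := Real.Gamma_pos_of_pos (by positivity)
  have hcoe : Measurable fun (u : Fin (d + 1) → Metric.sphere (0 : EuclideanSpace ℝ (Fin d)) 1) k =>
      (u k : EuclideanSpace ℝ (Fin d)) := by fun_prop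
  have hflip : ∀ ε : Fin d → ℤˣ, Measurable
      fun u : Fin (d + 1) → EuclideanSpace ℝ (Fin d) => flipTail ε u := fun ε => by
    refine measurable_pi_iff.2 fun k => ?_
    refine Fin.cases ?_ (fun j => ?_) k <;> simp only [flipTail, Fin.cons_zero, Fin.cons_succ] <;>
      fun_prop
  have hrepl : ∀ i, Measurable
      fun u : Fin (d + 1) → Metric.sphere (0 : EuclideanSpace ℝ (Fin d)) 1 =>
        ENNReal.ofReal |replacedDet (fun k => (u k : EuclideanSpace ℝ (Fin d))) i| :=
    fun i => (((continuous_replacedDet i).measurable.comp hcoe).abs).ennreal_ofReal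
  have hsigned : ∀ ε, Measurable
      fun u : Fin (d + 1) → Metric.sphere (0 : EuclideanSpace ℝ (Fin d)) 1 =>
        ENNReal.ofReal (signedVolume (flipTail ε fun k => (u k : EuclideanSpace ℝ (Fin d)))) :=
    fun ε => (measurable_signedVolume.comp ((hflip ε).comp hcoe)).ennreal_ofReal
  have hint : ∀ i, ∫⁻ u, ENNReal.ofReal |replacedDet (fun k => (u k : EuclideanSpace ℝ (Fin d))) i|
      ∂(sphereTuple (d + 1) d) = ENNReal.ofReal D := fun i => by
    simp_rw [replacedDet_coe]
    rw [hD, ← lintegral_abs_rowDet_uniformSphere hd,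
      ← (measurePreserving_pi_comp (uniformSphere d) (injective_update_succ i)).lintegral_comp]
    exact (measurable_rowDet.comp (by fun_prop)).abs.ennreal_ofReal
  -- All 2^d sign changes contribute the same integral `L`, while their pointwise sum is almost
  -- surely a multiple of ∑ |R_i|.
  have hsum : (2 : ENNReal) ^ d * L = ENNReal.ofReal (2 / d.factorial) * (d * ENNReal.ofReal D) := by
    calc (2 : ENNReal) ^ d * L
        = ∑ ε : Fin d → ℤˣ, ∫⁻ u, ENNReal.ofReal
            (signedVolume (flipTail ε fun k => (u k : EuclideanSpace ℝ (Fin d))))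
              ∂(sphereTuple (d + 1) d) := by
          simp_rw [lintegral_signedVolume_flipTail hd]
          simp [L]
      _ = ∫⁻ u, ENNReal.ofReal (2 / d.factorial) *
            ∑ i, ENNReal.ofReal |replacedDet (fun k => (u k : EuclideanSpace ℝ (Fin d))) i|
              ∂(sphereTuple (d + 1) d) := by
          rw [← lintegral_finsetSum _ fun ε _ => hsigned ε]
          refine lintegral_congr_ae ?_
          filter_upwards [sphereTuple_generic hd] with u hu
          rw [← ENNReal.ofReal_sum_of_nonneg fun ε _ => signedVolume_nonneg _,
            sum_signedVolume_flipTail hd hu.2 fun k => norm_eq_of_mem_sphere (u k),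
            ENNReal.ofReal_mul (by positivity),
            ENNReal.ofReal_sum_of_nonneg fun i _ => abs_nonneg _]
      _ = ENNReal.ofReal (2 / d.factorial) * (d * ENNReal.ofReal D) := by
          rw [lintegral_const_mul _ (Finset.measurable_fun_sum _ fun i _ => hrepl i),
            lintegral_finsetSum _ fun i _ => hrepl i]
          simp [hint]
  have hL : L = ENNReal.ofReal (2 / d.factorial) * (d * ENNReal.ofReal D) / 2 ^ d :=
    (ENNReal.eq_div_iff (by simp) (by simp)).2 hsum
  have h2 : (2 : ENNReal) ^ d = ENNReal.ofReal (2 ^ d) := by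
    rw [ENNReal.ofReal_pow zero_le_two, ENNReal.ofReal_ofNat]
  rw [hL, h2, ← ENNReal.ofReal_natCast, ← ENNReal.ofReal_mul (by positivity),
    ← ENNReal.ofReal_mul (by positivity), ← ENNReal.ofReal_div_of_pos (by positivity)]
  congr 1
  rw [hD, expectedVolume]
  obtain ⟨m, rfl⟩ := Nat.exists_eq_add_of_le' hd
  rw [Nat.add_sub_cancel, Nat.factorial_succ]
  push_cast at hΓ hΓ' ⊢
  field_simp
  ring

theorem expectedVolumeOn_eq (hd : 1 ≤ d) {Ω : Type*} [MeasurableSpace Ω] (P : Measure Ω)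
    [IsProbabilityMeasure P]
    (U : Fin (d + 1) → Ω → Metric.sphere (0 : EuclideanSpace ℝ (Fin d)) 1)
    (hU : IIDUniformSphere d P U) {S : Set (Fin (d + 1) → EuclideanSpace ℝ (Fin d))}
    (hS : relintConfigurations d ⊆ S) (hS' : S ⊆ hullConfigurations d) :
    expectedVolumeOn P U S = expectedVolume d := by
  have := isProbabilityMeasure_uniformSphere hd
  have hlaw : HasLaw (fun ω i => U i ω) (sphereTuple (d + 1) d) P :=
    hU.indep.hasLaw_pi hU.hasLaw
  have hmeas : Measurable fun u : Fin (d + 1) → Metric.sphere (0 : EuclideanSpace ℝ (Fin d)) 1 =>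
      signedVolume fun k => (u k : EuclideanSpace ℝ (Fin d)) :=
    measurable_signedVolume.comp (by fun_prop)
  have hgen : ∀ᵐ ω ∂P, S.indicator simplexVolume (fun i => (U i ω : EuclideanSpace ℝ (Fin d))) =
      signedVolume fun i => (U i ω : EuclideanSpace ℝ (Fin d)) := by
    have h := sphereTuple_generic hd
    rw [← hlaw.map_eq] at h
    filter_upwards [ae_of_ae_map hlaw.aemeasurable h] with ω hω
    exact indicator_simplexVolume_eq hd hS hS' hω.1 hω.2
  rw [expectedVolumeOn, integral_congr_ae hgen]
  have hcomp := hlaw.integral_comp (f := fun u => signedVolume fun k =>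
    (u k : EuclideanSpace ℝ (Fin d))) hmeas.aestronglyMeasurable
  rw [Function.comp_def] at hcomp
  rw [hcomp, integral_eq_lintegral_of_nonneg_ae (ae_of_all _ fun u => signedVolume_nonneg _)
    hmeas.aestronglyMeasurable, lintegral_signedVolume hd,
    ENNReal.toReal_ofReal (expectedVolume_nonneg d)]

theorem expectedVolume_recursion (hd : 2 ≤ d) :
    expectedVolume d = 1 / (2 * ((d : ℝ) - 1)) *
      (beta ((d : ℝ) / 2) (1 / 2) / beta (((d : ℝ) - 1) / 2) (1 / 2)) ^ (d - 1) *
        expectedVolume (d - 1) := by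
  obtain ⟨m, rfl⟩ := Nat.exists_eq_add_of_le' hd
  have e1 : m + 2 - 1 = m + 1 := rfl
  have hΓ1 : 0 < Real.Gamma (((m : ℝ) + 1) / 2) := Real.Gamma_pos_of_pos (by positivity)
  have hΓ2 : 0 < Real.Gamma (((m : ℝ) + 2) / 2) := Real.Gamma_pos_of_pos (by positivity)
  have hΓ3 : 0 < Real.Gamma (((m : ℝ) + 3) / 2) := Real.Gamma_pos_of_pos (by positivity)
  have hπ : 0 < Real.Gamma (1 / 2) := Real.Gamma_pos_of_pos (by positivity)
  simp only [expectedVolume, beta, e1, Nat.add_sub_cancel, Nat.factorial_succ]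
  push_cast
  rw [show (m : ℝ) + 2 + 1 = m + 3 by ring, show (m : ℝ) + 2 - 1 = m + 1 by ring,
    show ((m : ℝ) + 1 + 1) / 2 = (m + 2) / 2 by ring,
    show ((m : ℝ) + 2) / 2 + 1 / 2 = (m + 3) / 2 by ring,
    show ((m : ℝ) + 1) / 2 + 1 / 2 = (m + 2) / 2 by ring]
  generalize Real.Gamma (((m : ℝ) + 1) / 2) = a at *
  generalize Real.Gamma (((m : ℝ) + 2) / 2) = b at *
  generalize Real.Gamma (((m : ℝ) + 3) / 2) = c at *
  generalize Real.Gamma (1 / 2) = e at *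
  -- With d = m + 2, this is the quotient of Beta values: Γ(1/2) cancels, leaving Γ(d/2)² /
  -- (Γ((d+1)/2) Γ((d-1)/2)).
  have : b * e / c / (a * e / b) = b ^ 2 / (c * a) := by field_simp
  rw [this, div_pow, mul_pow, ← pow_mul]
  field_simp
  ring

end Expectation

theorem theorem2 (d : ℕ) (hd : 1 ≤ d)
    {Ω : Type*} [MeasurableSpace Ω] (P : Measure Ω) [IsProbabilityMeasure P]
    (U : Fin (d + 1) → Ω → Metric.sphere (0 : EuclideanSpace ℝ (Fin d)) 1)
    (hU : IIDUniformSphere d P U) :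
    (expectedVolumeOn P U (hullConfigurations d)
        = Real.Gamma ((d : ℝ) / 2) ^ d
          / (2 ^ (d - 1) * Real.sqrt Real.pi * ((d - 1).factorial : ℝ)
              * Real.Gamma (((d : ℝ) + 1) / 2) ^ (d - 1))) ∧
    (expectedVolumeOn P U (relintConfigurations d)
        = Real.Gamma ((d : ℝ) / 2) ^ d
          / (2 ^ (d - 1) * Real.sqrt Real.pi * ((d - 1).factorial : ℝ)
              * Real.Gamma (((d : ℝ) + 1) / 2) ^ (d - 1))) ∧
    (2 ≤ d →
      ∀ {Ω' : Type*} [MeasurableSpace Ω'] (P' : Measure Ω') [IsProbabilityMeasure P']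
        (V : Fin ((d - 1) + 1) → Ω' →
          Metric.sphere (0 : EuclideanSpace ℝ (Fin (d - 1))) 1),
        IIDUniformSphere (d - 1) P' V →
        (expectedVolumeOn P U (hullConfigurations d)
          = 1 / (2 * ((d : ℝ) - 1))
            * (beta ((d : ℝ) / 2) (1 / 2) / beta (((d : ℝ) - 1) / 2) (1 / 2)) ^ (d - 1)
            * expectedVolumeOn P' V (hullConfigurations (d - 1))) ∧
        (expectedVolumeOn P U (relintConfigurations d)
          = 1 / (2 * ((d : ℝ) - 1))
            * (beta ((d : ℝ) / 2) (1 / 2) / beta (((d : ℝ) - 1) / 2) (1 / 2)) ^ (d - 1)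
            * expectedVolumeOn P' V (relintConfigurations (d - 1)))) := by

  have hhull {n : ℕ} := relintConfigurations_subset_hullConfigurations (d := n)
  refine ⟨expectedVolumeOn_eq hd P U hU hhull subset_rfl,
    expectedVolumeOn_eq hd P U hU subset_rfl hhull, fun hd' Ω' _ P' _ V hV => ⟨?_, ?_⟩⟩
  · rw [expectedVolumeOn_eq hd P U hU hhull subset_rfl,
      expectedVolumeOn_eq (by omega) P' V hV hhull subset_rfl, ← expectedVolume_recursion hd']
  · rw [expectedVolumeOn_eq hd P U hU subset_rfl hhull,
      expectedVolumeOn_eq (by omega) P' V hV subset_rfl hhull, ← expectedVolume_recursion hd']
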